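/- All graphs are finite and simple. The chromatic polynomial $P(G,t)$ is the polynomial whose value at each non-negative integer $t$ is the number of proper $t$-colourings of $G$. A double subdivision of an edge $uv$ of a graph $G$ deletes $uv$, adds two new vertices and joins both of them to $u$ and $v$. A generalised triangle is $K_3$ or any graph obtained from $K_3$ by a sequence of double subdivisions. A 2-cut of $G$ is a set $\{x,y\}$ of two distinct vertices whose removal increases the number of components of $G$; the $\{x,y\}$-bridges of $G$ are the induced subgraphs $G[V(C)\cup\{x,y\}]$, where $C$ ranges over the components of $G-\{x,y\}$. The 2-cut $\{x,y\}$ has property $P_1$ if in every $\{x,y\}$-bridge $B$ at least one of $x$ and $y$ has degree $1$ in $B$. Let $\mathcal{K}_1$ be the class of generalised triangles in which every 2-cut has property $P_1$. Lemma. If $G\in\mathcal{K}_1$, then $(-1)^{|V(G)|}P(G,t)>0$ for all $t\in(1,5/4]$. -/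

import Mathlib

open scoped Polynomial

universe u

namespace SimpleGraph

/-! ### The chromatic polynomial -/

/-- A function on the vertices is constant along the edges in `F` exactly if it factors through the
components of the graph with edge set `F`; so there are `n ^ c(F)` such functions to `Fin n`. -/
theorem card_constant_on_edges {V : Type u} [Finite V] (F : Set (Sym2 V)) (n : ℕ) :
    Nat.card {f : V → Fin n // ∀ a b, s(a, b) ∈ F → f a = f b} =
      n ^ Nat.card (fromEdgeSet F).ConnectedComponent := by
  have e : {f : V → Fin n // ∀ a b, s(a, b) ∈ F → f a = f b} ≃
      ((fromEdgeSet F).ConnectedComponent → Fin n) :=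
    { toFun := fun f => fun c => c.lift f.1 (by
        intro v w p _
        induction p with
        | nil => rfl
        | cons h _ ih =>
          rename_i hp
          rw [fromEdgeSet_adj] at h
          exact (f.2 _ _ h.1).trans (ih hp.of_cons))
      invFun := fun g => ⟨fun v => g ((fromEdgeSet F).connectedComponentMk v), by
        intro a b hab
        by_cases h : a = b
        · rw [h]
        · exact congrArg g <| ConnectedComponent.sound (Adj.reachable ((fromEdgeSet_adj F).2 ⟨hab, h⟩))⟩
      left_inv := fun f => rfl
      right_inv := fun g => by
        funext c
        induction c using ConnectedComponent.ind with
        | h v => rfl }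
  rw [Nat.card_congr e, Nat.card_fun, Nat.card_fin]

open Classical in
/-- There is exactly one polynomial whose value at every natural number `n` is the number of proper
`n`-colourings of the finite graph `G`. -/
theorem existsUnique_chromaticPolynomial {V : Type u} [Finite V] (G : SimpleGraph V) :
    ∃! p : ℤ[X], ∀ n : ℕ, p.eval (n : ℤ) = (Nat.card (G.Coloring (Fin n)) : ℤ) := by
  have := Fintype.ofFinite V
  refine existsUnique_of_exists_of_unique
    ⟨∑ F ∈ G.edgeFinset.powerset, (-1) ^ F.card *
      Polynomial.X ^ Nat.card (fromEdgeSet (F : Set (Sym2 V))).ConnectedComponent, ?_⟩ ?_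
  · intro n
    have hcol : (Nat.card (G.Coloring (Fin n)) : ℤ) =
        ∑ f : V → Fin n, ∏ e ∈ G.edgeFinset, (1 + -(if (e.map f).IsDiag then 1 else 0)) := by
      have e : G.Coloring (Fin n) ≃ {f : V → Fin n // ∀ a b, G.Adj a b → f a ≠ f b} :=
        { toFun := fun c => ⟨c, fun a b h => c.valid h⟩
          invFun := fun f => Coloring.mk f.1 (fun {a b} h => f.2 a b h)
          left_inv := fun c => rfl
          right_inv := fun f => rfl }
      rw [Nat.card_congr e, Nat.card_eq_fintype_card, Fintype.card_subtype,
        Finset.card_filter, Nat.cast_sum]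
      refine Finset.sum_congr rfl fun f _ => ?_
      split_ifs with h
      · rw [Finset.prod_eq_one]
        · rfl
        · intro e he
          induction e using Sym2.ind with
          | h a b =>
            rw [mem_edgeFinset, mem_edgeSet] at he
            simp [h a b he]
      · push Not at h
        obtain ⟨a, b, hab, hf⟩ := h
        rw [Finset.prod_eq_zero (i := s(a, b)) (by simpa using hab) (by simp [hf])]
        rfl
    rw [hcol, Polynomial.eval_finsetSum]
    simp_rw [Finset.prod_one_add]
    rw [Finset.sum_comm]
    refine Finset.sum_congr rfl fun F _ => ?_
    have hF : (Nat.card {f : V → Fin n // ∀ a b, s(a, b) ∈ (F : Set (Sym2 V)) → f a = f b} : ℤ) =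
        ∑ f : V → Fin n, ∏ e ∈ F, (if (e.map f).IsDiag then (1 : ℤ) else 0) := by
      rw [Nat.card_eq_fintype_card, Fintype.card_subtype, Finset.card_filter, Nat.cast_sum]
      refine Finset.sum_congr rfl fun f _ => ?_
      split_ifs with h
      · rw [Finset.prod_eq_one]
        · rfl
        · intro e he
          induction e using Sym2.ind with
          | h a b => simp [h a b he]
      · push Not at h
        obtain ⟨a, b, hab, hf⟩ := h
        rw [Finset.prod_eq_zero (i := s(a, b)) hab (by simp [hf])]
        rfl
    rw [card_constant_on_edges] at hF
    simp only [Finset.prod_neg, ← Finset.mul_sum, ← hF]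
    simp
  · intro p q hp hq
    refine Polynomial.eq_of_infinite_eval_eq p q
      ((Set.infinite_range_of_injective (Nat.cast_injective (R := ℤ))).mono ?_)
    rintro _ ⟨n, rfl⟩
    exact (hp n).trans (hq n).symm

/-- The chromatic polynomial of a finite graph: the polynomial that counts, for each natural number
`n`, the proper `n`-colourings. -/
noncomputable def chromaticPolynomial {V : Type u} [Finite V] (G : SimpleGraph V) : ℤ[X] :=
  (existsUnique_chromaticPolynomial G).choose

theorem chromaticPolynomial_eval {V : Type u} [Finite V] (G : SimpleGraph V) (n : ℕ) :
    G.chromaticPolynomial.eval (n : ℤ) = (Nat.card (G.Coloring (Fin n)) : ℤ) :=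
  (existsUnique_chromaticPolynomial G).choose_spec.1 n

/-! ### Generalised triangles -/

/-- Double subdivision of the edge `uv`: delete `uv`, add two new vertices (`Sum.inr 0` and
`Sum.inr 1`) and join both of them to `u` and to `v`, and to nothing else. -/
def doubleSubdivision {V : Type u} (G : SimpleGraph V) (u v : V) : SimpleGraph (V ⊕ Fin 2) where
  Adj
    | .inl a, .inl b => G.Adj a b ∧ s(a, b) ≠ s(u, v)
    | .inl a, .inr _ => a = u ∨ a = v
    | .inr _, .inl b => b = u ∨ b = v
    | .inr _, .inr _ => False
  symm := ⟨by
    rintro (a | i) (b | j) h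
    · exact ⟨h.1.symm, by rw [Sym2.eq_swap]; exact h.2⟩
    · exact h
    · exact h
    · exact h⟩
  loopless := ⟨by
    rintro (a | i) h
    · exact G.loopless.irrefl a h.1
    · exact h⟩

/-- A generalised triangle is (up to isomorphism) `K₃` or a graph that arises from `K₃` by a
sequence of double subdivisions of edges. -/
inductive IsGeneralisedTriangle : ∀ {V : Type u}, SimpleGraph V → Prop
  | triangle {V : Type u} (G : SimpleGraph V)
      (e : G ≃g (⊤ : SimpleGraph (Fin 3))) : IsGeneralisedTriangle G
  | doubleSubdivision {V W : Type u} (G : SimpleGraph V) (G' : SimpleGraph W) (u v : V)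
      (hG : IsGeneralisedTriangle G) (huv : G.Adj u v)
      (e : G' ≃g G.doubleSubdivision u v) : IsGeneralisedTriangle G'

/-! ### 2-cuts, bridges and the class `K₁` -/

/-- A set `S` of vertices of a finite graph is a cut-set if its removal increases the number of
components. -/
def IsCutSet {V : Type u} (G : SimpleGraph V) (S : Set V) : Prop :=
  Nat.card G.ConnectedComponent < Nat.card (G.ComponentCompl S)

/-- `{x, y}` is a 2-cut of `G`: a cut-set with exactly two elements. -/
def IsTwoCut {V : Type u} (G : SimpleGraph V) (x y : V) : Prop :=
  x ≠ y ∧ G.IsCutSet {x, y}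

/-- The `{x, y}`-bridge of `G` that belongs to the component `C` of `G - {x, y}`: the subgraph of
`G` induced by `V(C) ∪ {x, y}`. -/
def bridge {V : Type u} (G : SimpleGraph V) (x y : V) (C : G.ComponentCompl {x, y}) : G.Subgraph :=
  (⊤ : G.Subgraph).induce (C.supp ∪ {x, y})

/-- Property `P₁` of the pair `{x, y}`: in every `{x, y}`-bridge at least one of `x`, `y` has
degree 1. -/
def HasPropertyP1 {V : Type u} (G : SimpleGraph V) (x y : V) : Prop :=
  ∀ C : G.ComponentCompl {x, y},
    ((G.bridge x y C).neighborSet x).ncard = 1 ∨ ((G.bridge x y C).neighborSet y).ncard = 1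

/-- The class `K₁`: generalised triangles all of whose 2-cuts have property `P₁`. -/
def IsInK1 {V : Type u} (G : SimpleGraph V) : Prop :=
  G.IsGeneralisedTriangle ∧ ∀ x y : V, G.IsTwoCut x y → G.HasPropertyP1 x y

end SimpleGraph

/-! Give each edge weights a (ends of different colours) and b (ends of equal colours), and sum the
product of the weights over all colourings; a = 1, b = 0 counts proper colourings. Summing out the
two new vertices of a double subdivision of uv gives back the smaller graph with new weights on uv
(`partitionFunction_eq`). Undoing all double subdivisions leaves a weighted triangle, whose value is
explicit.

For 1 < t ≤ 5/4 the invariant is a > 0 and b ≤ a/4. It survives a step if each of the two paths from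
u to v through a new vertex has an edge with b = 0 (`series_bounds`); one such edge makes the
triangle negative (`triangle_neg`). The order of the graph is odd, so this is the claimed sign.

The zeros come from P₁. Let R be the set of edges with b = 0. An edge outside R arose from a
reduction and stands for a larger piece, so its ends form a 2-cut of the original graph.
`IsReducible` is what P₁ says of the reduced graph, and it passes down every step
(`IsDoubleSubdivisionMap.isReducible`). -/

namespace SimpleGraph

/-! ### Double subdivisions, and edges whose ends do not separate -/

/-- The data of a double subdivision, up to isomorphism: `ι` embeds the old vertices and `m` lists
the two new ones. -/
structure IsDoubleSubdivisionMap {V W : Type u} (G : SimpleGraph V) (G' : SimpleGraph W) (u v : V)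
    (ι : V → W) (m : Fin 2 → W) : Prop where
  inj : Function.Injective ι
  new_inj : Function.Injective m
  ne : ∀ x i, ι x ≠ m i
  cover : ∀ w, (∃ x, w = ι x) ∨ ∃ i, w = m i
  base : G.Adj u v
  adj_old : ∀ x y, G'.Adj (ι x) (ι y) ↔ G.Adj x y ∧ s(x, y) ≠ s(u, v)
  adj_new : ∀ x i, G'.Adj (ι x) (m i) ↔ x = u ∨ x = v
  not_adj_new : ∀ i j, ¬ G'.Adj (m i) (m j)

theorem IsDoubleSubdivisionMap.of_iso {V W : Type u} {G : SimpleGraph V} {G' : SimpleGraph W}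
    {u v : V} (huv : G.Adj u v) (e : G' ≃g G.doubleSubdivision u v) :
    IsDoubleSubdivisionMap G G' u v (fun x => e.symm (.inl x)) (fun i => e.symm (.inr i)) where
  inj := e.symm.injective.comp Sum.inl_injective
  new_inj := e.symm.injective.comp Sum.inr_injective
  ne x i h := by simpa using e.symm.injective h
  cover w := by
    rcases h : e w with x | i
    · exact .inl ⟨x, by simp [← h]⟩
    · exact .inr ⟨i, by simp [← h]⟩
  base := huv
  adj_old x y := e.symm.map_adj_iff
  adj_new x i := e.symm.map_adj_iff
  not_adj_new i j h := e.symm.map_adj_iff.1 h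

theorem IsDoubleSubdivisionMap.symm {V W : Type u} {G : SimpleGraph V} {G' : SimpleGraph W}
    {u v : V} {ι : V → W} {m : Fin 2 → W} (h : IsDoubleSubdivisionMap G G' u v ι m) :
    IsDoubleSubdivisionMap G G' v u ι m where
  inj := h.inj
  new_inj := h.new_inj
  ne := h.ne
  cover := h.cover
  base := h.base.symm
  adj_old x y := by rw [h.adj_old, Sym2.eq_swap (a := u)]
  adj_new x i := by rw [h.adj_new, or_comm]
  not_adj_new := h.not_adj_new

/-- Every vertex has at least two neighbours. -/
def MinDegreeTwo {V : Type u} (G : SimpleGraph V) : Prop :=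
  ∀ v w, ∃ z, G.Adj v z ∧ z ≠ w

/-- `C` is a union of components of `G - {x, y}`. -/
def IsClosedOff {V : Type u} (G : SimpleGraph V) (x y : V) (C : Set V) : Prop :=
  x ∉ C ∧ y ∉ C ∧ ∀ c ∈ C, ∀ d, G.Adj c d → d ∈ C ∨ d = x ∨ d = y

/-- The ends of an edge never separate the graph. -/
def EdgesNonseparating {V : Type u} (G : SimpleGraph V) : Prop :=
  ∀ x y, G.Adj x y → ∀ C, G.IsClosedOff x y C → C.Nonempty → ∀ z, z = x ∨ z = y ∨ z ∈ C

theorem IsClosedOff.symm {V : Type u} {G : SimpleGraph V} {x y : V} {C : Set V}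
    (h : G.IsClosedOff x y C) : G.IsClosedOff y x C :=
  ⟨h.2.1, h.1, fun c hc d hd => (h.2.2 c hc d hd).imp_right Or.symm⟩

namespace IsDoubleSubdivisionMap

variable {V W : Type u} {G : SimpleGraph V} {G' : SimpleGraph W} {u v : V} {ι : V → W}
  {m : Fin 2 → W}

theorem minDegreeTwo (h : IsDoubleSubdivisionMap G G' u v ι m) (hG : G.MinDegreeTwo) :
    G'.MinDegreeTwo := by
  intro a w
  have h01 : m 0 ≠ m 1 := fun e => by simpa using h.new_inj e
  rcases h.cover a with ⟨x, rfl⟩ | ⟨i, rfl⟩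
  · by_cases hx : x = u ∨ x = v
    · by_cases hw : m 0 = w
      · exact ⟨m 1, (h.adj_new x 1).2 hx, fun e => h01 (hw.trans e.symm)⟩
      · exact ⟨m 0, (h.adj_new x 0).2 hx, hw⟩
    · have key : ∀ z, G.Adj x z → G'.Adj (ι x) (ι z) := fun z hz =>
        (h.adj_old x z).2 ⟨hz, by grind⟩
      rcases h.cover w with ⟨y, rfl⟩ | ⟨i, rfl⟩
      · obtain ⟨z, hz, hzy⟩ := hG x y
        exact ⟨ι z, key z hz, h.inj.ne hzy⟩
      · obtain ⟨z, hz, -⟩ := hG x x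
        exact ⟨ι z, key z hz, h.ne z i⟩
  · by_cases hw : ι u = w
    · exact ⟨ι v, ((h.adj_new v i).2 (.inr rfl)).symm, fun e =>
        h.base.ne (h.inj (hw.trans e.symm))⟩
    · exact ⟨ι u, ((h.adj_new u i).2 (.inl rfl)).symm, hw⟩

theorem isClosedOff_preimage (h : IsDoubleSubdivisionMap G G' u v ι m) {x y : V} {C : Set W}
    (hC : G'.IsClosedOff (ι x) (ι y) C) : G.IsClosedOff x y (ι ⁻¹' C) := by
  refine ⟨hC.1, hC.2.1, fun c hc d hcd => ?_⟩
  have hi := h.inj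
  by_cases he : s(c, d) = s(u, v)
  -- The edge uv is missing from G'; the path through `m 0` takes its place.
  · have h1 := hC.2.2 (ι c) hc (m 0) ((h.adj_new c 0).2 (by grind))
    have h2 := hC.2.2 (m 0) (by grind [h.ne]) (ι d) ((h.adj_new d 0).2 (by grind)).symm
    simpa [hi.eq_iff] using h2
  · simpa [hi.eq_iff] using hC.2.2 (ι c) hc (ι d) ((h.adj_old c d).2 ⟨hcd, he⟩)

/-- As {x, y} ≠ {u, v}, at least one of the neighbours u, v of `m i` is not removed. -/
theorem old_mem_of_new_mem (h : IsDoubleSubdivisionMap G G' u v ι m) {x y : V} {C : Set W}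
    (hC : G'.IsClosedOff (ι x) (ι y) C) (hxy : s(x, y) ≠ s(u, v)) {i : Fin 2} (hi : m i ∈ C) :
    ι u ∈ C ∨ ι v ∈ C := by
  have h1 := hC.2.2 _ hi (ι u) ((h.adj_new u i).2 (.inl rfl)).symm
  have h2 := hC.2.2 _ hi (ι v) ((h.adj_new v i).2 (.inr rfl)).symm
  have := h.base.ne
  have := h.inj
  simp only [h.inj.eq_iff] at h1 h2
  grind

theorem new_mem_of_old_mem (h : IsDoubleSubdivisionMap G G' u v ι m) {x y : V} {C : Set W}
    (hC : G'.IsClosedOff (ι x) (ι y) C) (i : Fin 2) (hi : ι u ∈ C ∨ ι v ∈ C) : m i ∈ C := by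
  rcases hi with hi | hi
  · have := hC.2.2 _ hi (m i) ((h.adj_new u i).2 (.inl rfl))
    grind [h.ne]
  · have := hC.2.2 _ hi (m i) ((h.adj_new v i).2 (.inr rfl))
    grind [h.ne]

/-- With u and `m i` removed, the other new vertex hangs on v, and v keeps an old neighbour y ≠ u.
The old vertices other than u, v hang together because uv does not separate G. -/
theorem nonseparating_new (h : IsDoubleSubdivisionMap G G' u v ι m) (hd : G.MinDegreeTwo)
    (hn : G.EdgesNonseparating) (i : Fin 2) (C : Set W) (hC : G'.IsClosedOff (ι u) (m i) C)
    (hne : C.Nonempty) (z : W) : z = ι u ∨ z = m i ∨ z ∈ C := by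
  obtain ⟨y, hvy, hyu⟩ := hd v u
  have hvy' : G'.Adj (ι v) (ι y) := (h.adj_old v y).2 ⟨hvy, by grind⟩
  have hyv := hvy.ne'
  have huv := h.base.ne
  -- Dropping v makes the set avoid both ends of uv, so that the hypothesis on G applies to it.
  have hcl : G.IsClosedOff u v {c | ι c ∈ C ∧ c ≠ v} := by
    refine ⟨fun hu => hC.1 hu.1, fun hv => hv.2 rfl, fun c hc d hcd => ?_⟩
    have hcu : c ≠ u := by rintro rfl; exact hC.1 hc.1
    have := hC.2.2 _ hc.1 (ι d) ((h.adj_old c d).2 ⟨hcd, by grind⟩)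
    have := h.ne d i
    have := h.inj.eq_iff (a := d) (b := u)
    grind
  have hj : ∀ j, j ≠ i → (m j ∈ C ↔ ι v ∈ C) := by
    intro j hji
    have hmj := h.new_inj.ne hji
    have hadj := (h.adj_new v j).2 (.inr rfl)
    have h1 := h.inj.ne huv
    have h2 := h.ne u j
    have h3 := h.ne v i
    constructor
    · intro hm
      have := hC.2.2 _ hm _ hadj.symm
      grind
    · intro hm
      have := hC.2.2 _ hm _ hadj
      grind
  have hyC : ι y ∈ C := by
    by_contra hyC
    have hvC : ι v ∉ C := fun hv => by
      have := hC.2.2 _ hv _ hvy'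
      have := h.ne y i
      have := h.inj.ne hyu
      grind
    obtain ⟨w, hw⟩ := hne
    rcases h.cover w with ⟨x, rfl⟩ | ⟨j, rfl⟩
    · have := hn u v h.base _ hcl ⟨x, hw, by rintro rfl; exact hvC hw⟩ y
      simp only [Set.mem_ofPred_eq] at this
      grind
    · have : j ≠ i := by rintro rfl; exact hC.2.1 hw
      exact hvC ((hj j this).1 hw)
  have hvC : ι v ∈ C := by
    have := hC.2.2 _ hyC _ hvy'.symm
    have := h.ne v i
    have := h.inj.ne huv
    grind
  rcases h.cover z with ⟨x, rfl⟩ | ⟨j, rfl⟩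
  · have := hn u v h.base _ hcl ⟨y, hyC, hyv⟩ x
    simp only [Set.mem_ofPred_eq] at this
    grind
  · by_cases hji : j = i
    · exact .inr (.inl (by rw [hji]))
    · exact .inr (.inr ((hj j hji).2 hvC))

theorem edgesNonseparating (h : IsDoubleSubdivisionMap G G' u v ι m) (hd : G.MinDegreeTwo)
    (hn : G.EdgesNonseparating) : G'.EdgesNonseparating := by
  intro a b hab C hC hne z
  rcases h.cover a with ⟨x, rfl⟩ | ⟨i, rfl⟩ <;> rcases h.cover b with ⟨y, rfl⟩ | ⟨j, rfl⟩
  · obtain ⟨hxy, hs⟩ := (h.adj_old x y).1 hab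
    have hcl := h.isClosedOff_preimage hC
    have hne0 : (ι ⁻¹' C).Nonempty := by
      obtain ⟨w, hw⟩ := hne
      rcases h.cover w with ⟨c, rfl⟩ | ⟨i, rfl⟩
      · exact ⟨c, hw⟩
      · rcases h.old_mem_of_new_mem hC hs hw with hu | hv
        exacts [⟨u, hu⟩, ⟨v, hv⟩]
    have key := hn x y hxy _ hcl hne0
    rcases h.cover z with ⟨c, rfl⟩ | ⟨i, rfl⟩
    · simpa [h.inj.eq_iff] using key c
    · have hu := key u
      have hv := key v
      have := h.base.ne
      simp only [Set.mem_preimage] at hu hv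
      exact .inr (.inr (h.new_mem_of_old_mem hC i (by grind)))
  · rcases (h.adj_new x j).1 hab with rfl | rfl
    · exact h.nonseparating_new hd hn j C hC hne z
    · exact h.symm.nonseparating_new hd hn j C hC hne z
  · rw [or_left_comm]
    rcases (h.adj_new y i).1 hab.symm with rfl | rfl
    · exact h.nonseparating_new hd hn i C hC.symm hne z
    · exact h.symm.nonseparating_new hd hn i C hC.symm hne z
  · exact absurd hab (h.not_adj_new i j)

end IsDoubleSubdivisionMap

theorem IsGeneralisedTriangle.minDegreeTwo_and_edgesNonseparating {V : Type u} {G : SimpleGraph V}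
    (hG : G.IsGeneralisedTriangle) : G.MinDegreeTwo ∧ G.EdgesNonseparating := by
  induction hG with
  | triangle G e =>
    have hadj : ∀ x y, G.Adj x y ↔ x ≠ y := fun x y => by
      rw [← e.map_adj_iff, top_adj, e.injective.ne_iff]
    have h3 : ∀ x y : Fin 3, ∃ z, x ≠ z ∧ z ≠ y := by decide
    refine ⟨fun x y => ?_, fun x y hxy C hC hne z => ?_⟩
    · obtain ⟨z, h1, h2⟩ := h3 (e x) (e y)
      refine ⟨e.symm z, (hadj _ _).2 ?_, ?_⟩
      · rintro rfl; simp at h1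
      · rintro rfl; simp at h2
    · obtain ⟨w, hw⟩ := hne
      by_contra! hz
      have := hC.2.2 w hw z ((hadj _ _).2 (by rintro rfl; exact hz.2.2 hw))
      grind
  | doubleSubdivision G G' u v _ huv e ih =>
    have h := IsDoubleSubdivisionMap.of_iso huv e
    exact ⟨h.minDegreeTwo ih.1, h.edgesNonseparating ih.1 ih.2⟩

theorem IsGeneralisedTriangle.odd_card {V : Type u} {G : SimpleGraph V}
    (hG : G.IsGeneralisedTriangle) : Finite V ∧ Odd (Nat.card V) := by
  induction hG with
  | triangle G e =>
    have := Finite.of_equiv _ e.toEquiv.symm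
    refine ⟨this, ?_⟩
    rw [Nat.card_congr e.toEquiv, Nat.card_fin]
    decide
  | doubleSubdivision G G' u v _ huv e ih =>
    obtain ⟨hV, ho⟩ := ih
    have := Finite.of_equiv _ e.toEquiv.symm
    refine ⟨this, ?_⟩
    rw [Nat.card_congr e.toEquiv, Nat.card_sum, Nat.card_fin]
    exact ho.add_even even_two

/-! ### Property P₁ under reversal of a double subdivision -/

/-- The vertex `x` has at most one neighbour in `C`, and the edge to it belongs to `R`. -/
def IsLeafTo {V : Type u} (G : SimpleGraph V) (R : Set (Sym2 V)) (x : V) (C : Set V) : Prop :=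
  ∀ z ∈ C, G.Adj x z → s(x, z) ∈ R ∧ ∀ z' ∈ C, G.Adj x z' → z' = z

/-- Property `P₁` of all 2-separations, for a graph in which the edges outside `R` stand for
larger pieces. -/
structure IsReducible {V : Type u} (G : SimpleGraph V) (R : Set (Sym2 V)) : Prop where
  leaf_of_separation : ∀ x y C, x ≠ y → G.IsClosedOff x y C → C.Nonempty →
    (∀ D ⊆ C, G.IsClosedOff x y D → D.Nonempty → D = C) → (∃ z, z ∉ C ∧ z ≠ x ∧ z ≠ y) →
    G.IsLeafTo R x C ∨ G.IsLeafTo R y C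
  leaf_of_edge : ∀ x y, G.Adj x y → s(x, y) ∉ R → G.IsLeafTo R x {y}ᶜ ∨ G.IsLeafTo R y {x}ᶜ

namespace IsDoubleSubdivisionMap

variable {V W : Type u} {G : SimpleGraph V} {G' : SimpleGraph W} {u v : V} {ι : V → W}
  {m : Fin 2 → W} {R : Set (Sym2 V)} {R' : Set (Sym2 W)}

/-- If the edge from u to `m i` is outside R', the edge clause makes one of its ends a leaf to the
rest. It is not u, which also sees the other new vertex and an old neighbour; so it is `m i`, and
its edge to v is in R'. -/
theorem new_edge_mem (h : IsDoubleSubdivisionMap G G' u v ι m) (hd : G.MinDegreeTwo)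
    (hr : G'.IsReducible R') (i : Fin 2) : s(ι u, m i) ∈ R' ∨ s(ι v, m i) ∈ R' := by
  by_contra! hcon
  have huv := h.inj.ne h.base.ne
  have hu := (h.adj_new u i).2 (.inl rfl)
  have hv := (h.adj_new v i).2 (.inr rfl)
  rcases hr.leaf_of_edge _ _ hu hcon.1 with hl | hl
  · obtain ⟨j, hj⟩ : ∃ j, j ≠ i := exists_ne i
    obtain ⟨z, hz, hzv⟩ := hd u v
    have hz' := (h.adj_old u z).2 ⟨hz, by grind⟩
    exact h.ne z j ((hl (m j) (h.new_inj.ne hj) ((h.adj_new u j).2 (.inl rfl))).2 (ι z)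
      (h.ne z i) hz')
  · have := (hl (ι v) huv.symm hv.symm).1
    rw [Sym2.eq_swap] at this
    exact hcon.2 this

theorem not_isLeafTo (h : IsDoubleSubdivisionMap G G' u v ι m) {x : V} (hx : x = u ∨ x = v)
    {C : Set W} (hC : ∀ i, m i ∈ C) : ¬ G'.IsLeafTo R' (ι x) C := fun hl => by
  simpa using h.new_inj ((hl (m 0) (hC 0) ((h.adj_new x 0).2 hx)).2 (m 1) (hC 1)
    ((h.adj_new x 1).2 hx))

theorem isLeafTo_of_isLeafTo (h : IsDoubleSubdivisionMap G G' u v ι m)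
    (hR : ∀ e, e ≠ s(u, v) → e.map ι ∈ R' → e ∈ R) {x : V} {C : Set V} {C' : Set W}
    (hC : ∀ c ∈ C, ι c ∈ C') (hx : ∀ z ∈ C, s(x, z) ≠ s(u, v))
    (hl : G'.IsLeafTo R' (ι x) C') : G.IsLeafTo R x C := fun z hz hxz =>
  ⟨hR _ (hx z hz) (hl _ (hC z hz) ((h.adj_old x z).2 ⟨hxz, hx z hz⟩)).1, fun z' hz' hxz' =>
    h.inj ((hl _ (hC z hz) ((h.adj_old x z).2 ⟨hxz, hx z hz⟩)).2 _ (hC z' hz')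
      ((h.adj_old x z').2 ⟨hxz', hx z' hz'⟩))⟩

/-- The old vertices other than u, v form one component of G' - {u, v}, since uv does not separate
G, and the new vertices lie outside it. So the separation clause of G' yields the edge clause for
uv. -/
theorem isLeafTo_base (h : IsDoubleSubdivisionMap G G' u v ι m) (hd : G.MinDegreeTwo)
    (hn : G.EdgesNonseparating) (hr : G'.IsReducible R')
    (hR : ∀ e, e ≠ s(u, v) → e.map ι ∈ R' → e ∈ R) :
    G.IsLeafTo R u {v}ᶜ ∨ G.IsLeafTo R v {u}ᶜ := by
  have huv := h.base.ne
  have hi := h.inj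
  obtain ⟨y, huy, hyv⟩ := hd u v
  have hyu := huy.ne'
  have hcl : G'.IsClosedOff (ι u) (ι v) (ι '' {u, v}ᶜ) := by
    refine ⟨by simp [hi.eq_iff], by simp [hi.eq_iff], ?_⟩
    rintro _ ⟨c, hc, rfl⟩ d hcd
    simp only [Set.mem_compl_iff, Set.mem_insert_iff, Set.mem_singleton_iff] at hc
    rcases h.cover d with ⟨d, rfl⟩ | ⟨i, rfl⟩
    · by_cases hd : d = u ∨ d = v
      · grind
      · exact .inl ⟨d, by simpa using hd, rfl⟩
    · exact absurd ((h.adj_new c i).1 hcd) hc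
  have key := hr.leaf_of_separation (ι u) (ι v) (ι '' {u, v}ᶜ) (hi.ne huv) hcl
    ⟨ι y, y, by simp [hyu, hyv], rfl⟩ (fun D hDC hD hne => ?_)
    ⟨m 0, by rintro ⟨x, -, hx⟩; exact h.ne x 0 hx, (h.ne u 0).symm, (h.ne v 0).symm⟩
  · have aux : ∀ x y : V, s(x, y) = s(u, v) → G'.IsLeafTo R' (ι x) (ι '' {u, v}ᶜ) →
        G.IsLeafTo R x {y}ᶜ := by
      intro x y hxy hl z hz hxz
      have hz' : z ≠ y := hz
      have aux2 : ∀ z, z ≠ y → G.Adj x z → ι z ∈ ι '' ({u, v}ᶜ : Set V) ∧ s(x, z) ≠ s(u, v) := by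
        intro z hz hxz
        have := hxz.ne
        refine ⟨⟨z, ?_, rfl⟩, ?_⟩
        · simp only [Set.mem_compl_iff, Set.mem_insert_iff, Set.mem_singleton_iff]
          grind
        · grind
      obtain ⟨h1, h2⟩ := aux2 z hz' hxz
      obtain ⟨h3, h4⟩ := hl _ h1 ((h.adj_old x z).2 ⟨hxz, h2⟩)
      refine ⟨hR _ h2 h3, fun w hw hxw => ?_⟩
      obtain ⟨h5, h6⟩ := aux2 w hw hxw
      exact hi (h4 _ h5 ((h.adj_old x w).2 ⟨hxw, h6⟩))
    exact key.imp (aux u v rfl) (aux v u Sym2.eq_swap)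
  · refine hDC.antisymm ?_
    rintro _ ⟨c, hc, rfl⟩
    have hne0 : (ι ⁻¹' D).Nonempty := by
      obtain ⟨w, hw⟩ := hne
      obtain ⟨c, -, rfl⟩ := hDC hw
      exact ⟨c, hw⟩
    have := hn u v h.base _ (h.isClosedOff_preimage hD) hne0 c
    simp only [Set.mem_compl_iff, Set.mem_insert_iff, Set.mem_singleton_iff,
      Set.mem_preimage] at hc this
    grind

/-- A component of G - {x, y} lifts to one of G' - {x, y}: the new vertices join it exactly when it
contains u or v. The edge clause for uv is `isLeafTo_base`, so it does not matter whether uv is in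
R. -/
theorem isReducible (h : IsDoubleSubdivisionMap G G' u v ι m) (hd : G.MinDegreeTwo)
    (hn : G.EdgesNonseparating) (hr : G'.IsReducible R')
    (hR : ∀ e, e ≠ s(u, v) → (e ∈ R ↔ e.map ι ∈ R')) : G.IsReducible R where
  leaf_of_separation x y C hxy hC hne hmin hout := by
    have hi := h.inj
    have huv := h.base.ne
    have hsep : s(x, y) ≠ s(u, v) := by
      intro he
      have hadj : G.Adj x y := by rw [← mem_edgeSet, he]; exact h.base
      obtain ⟨z, hz⟩ := hout
      have := hn x y hadj C hC hne z
      tauto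
    set C' : Set W := {w | (∃ c ∈ C, w = ι c) ∨ ((u ∈ C ∨ v ∈ C) ∧ ∃ i, w = m i)} with hC'
    have hold : ∀ c, ι c ∈ C' ↔ c ∈ C := by
      intro c
      have := fun i => h.ne c i
      simp [hC', hi.eq_iff, this]
    have hnew : ∀ i, m i ∈ C' ↔ u ∈ C ∨ v ∈ C := by
      intro i
      have := fun c => (h.ne c i).symm
      simp only [hC', Set.mem_ofPred_eq, this, and_false, exists_false, false_or]
      exact and_iff_left ⟨i, rfl⟩
    have hbase : ∀ w, w = u ∨ w = v → (u ∈ C ∨ v ∈ C) → w ∈ C ∨ w = x ∨ w = y := by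
      rintro w hw (hu | hv)
      · have := hC.2.2 u hu v h.base
        grind
      · have := hC.2.2 v hv u h.base.symm
        grind
    have hcl : G'.IsClosedOff (ι x) (ι y) C' := by
      refine ⟨fun hx => hC.1 ((hold x).1 hx), fun hy => hC.2.1 ((hold y).1 hy), ?_⟩
      intro c hc d hcd
      rcases h.cover c with ⟨c, rfl⟩ | ⟨i, rfl⟩ <;> rcases h.cover d with ⟨d, rfl⟩ | ⟨j, rfl⟩
      · rw [hold, hi.eq_iff, hi.eq_iff]
        exact hC.2.2 c ((hold c).1 hc) d ((h.adj_old c d).1 hcd).1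
      · left
        rw [hnew]
        have := (hold c).1 hc
        rcases (h.adj_new c j).1 hcd with rfl | rfl <;> tauto
      · rw [hold, hi.eq_iff, hi.eq_iff]
        exact hbase d ((h.adj_new d i).1 hcd.symm) ((hnew i).1 hc)
      · exact absurd hcd (h.not_adj_new i j)
    have key := hr.leaf_of_separation (ι x) (ι y) C' (hi.ne hxy) hcl
      (by obtain ⟨c, hc⟩ := hne; exact ⟨ι c, (hold c).2 hc⟩) (fun D hDC hD hDne => ?_)
      (by
        obtain ⟨z, hz, hzx, hzy⟩ := hout
        exact ⟨ι z, fun hz' => hz ((hold z).1 hz'), hi.ne hzx, hi.ne hzy⟩)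
    · have aux : ∀ x, x ∉ C → G'.IsLeafTo R' (ι x) C' → G.IsLeafTo R x C := by
        intro x hx hl
        refine h.isLeafTo_of_isLeafTo (fun e he => (hR e he).2) (fun c => (hold c).2) ?_ hl
        intro z hz he
        -- If xz were uv, then z ∈ C would put both new vertices into C', giving x two neighbours
        -- there.
        refine h.not_isLeafTo (R' := R') (x := x) (by grind) (fun i => (hnew i).2 ?_) hl
        grind
      exact key.imp (aux x hC.1) (aux y hC.2.1)
    · have hsub : ι ⁻¹' D ⊆ C := fun c hc => (hold c).1 (hDC hc)
      have heq : ι ⁻¹' D = C := by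
        refine hmin _ hsub (h.isClosedOff_preimage hD) ?_
        obtain ⟨w, hw⟩ := hDne
        rcases h.cover w with ⟨c, rfl⟩ | ⟨i, rfl⟩
        · exact ⟨c, hw⟩
        · rcases h.old_mem_of_new_mem hD hsep hw with hu | hv
          exacts [⟨u, hu⟩, ⟨v, hv⟩]
      refine hDC.antisymm ?_
      rintro w hw
      rcases h.cover w with ⟨c, rfl⟩ | ⟨i, rfl⟩
      · rw [hold, ← heq] at hw
        exact hw
      · rw [hnew, ← heq] at hw
        exact h.new_mem_of_old_mem hD i hw
  leaf_of_edge x y hxy hxyR := by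
    by_cases he : s(x, y) = s(u, v)
    · have key := h.isLeafTo_base hd hn hr (fun e he => (hR e he).2)
      rcases Sym2.eq_iff.1 he with ⟨rfl, rfl⟩ | ⟨rfl, rfl⟩
      · exact key
      · exact key.symm
    · have aux : ∀ x y, G'.IsLeafTo R' (ι x) {ι y}ᶜ → G.IsLeafTo R x {y}ᶜ := by
        intro x y hl
        have hx : ¬ (x = u ∨ x = v) := fun hx =>
          h.not_isLeafTo hx (fun i => (h.ne y i).symm) hl
        exact h.isLeafTo_of_isLeafTo (fun e he => (hR e he).2) (fun c hc => h.inj.ne hc)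
          (fun z _ he => hx (by grind)) hl
      exact (hr.leaf_of_edge (ι x) (ι y) ((h.adj_old x y).2 ⟨hxy, he⟩)
        (fun hm => hxyR ((hR _ he).2 hm))).imp (aux x y) (aux y x)

end IsDoubleSubdivisionMap

/-! ### From property P₁ of 2-cuts to reducibility -/

theorem exists_componentCompl_supp_eq {V : Type u} {G : SimpleGraph V} {x y : V} {C : Set V}
    (hC : G.IsClosedOff x y C) (hne : C.Nonempty)
    (hmin : ∀ D ⊆ C, G.IsClosedOff x y D → D.Nonempty → D = C) :
    ∃ K : G.ComponentCompl {x, y}, K.supp = C := by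
  obtain ⟨c, hc⟩ := hne
  have hcK : c ∉ ({x, y} : Set V) := by
    rintro (rfl | rfl)
    exacts [hC.1 hc, hC.2.1 hc]
  refine ⟨G.componentComplMk hcK, hmin _ ?_ ⟨?_, ?_, ?_⟩ ⟨c, G.componentComplMk_mem hcK⟩⟩
  · rintro d ⟨hd, he⟩
    obtain ⟨p⟩ := ConnectedComponent.exact he.symm
    suffices ∀ a b : ({x, y}ᶜ : Set V), (G.induce ({x, y}ᶜ)).Walk a b → a.1 ∈ C → b.1 ∈ C from
      this _ _ p hc
    intro a b p
    induction p with
    | nil => exact id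
    | @cons a b _ hab _ ih =>
      intro ha
      refine ih ?_
      have := hC.2.2 _ ha b.1 hab
      have hb := b.2
      simp only [Set.mem_compl_iff, Set.mem_insert_iff, Set.mem_singleton_iff] at hb
      tauto
  · exact fun hx => (ComponentCompl.notMem_of_mem hx) (by simp)
  · exact fun hx => (ComponentCompl.notMem_of_mem hx) (by simp)
  · intro a ha d had
    by_cases hd : d = x ∨ d = y
    · exact .inr hd
    · exact .inl (ComponentCompl.mem_of_adj a d ha (by simpa using hd) had)

/-- For an edge xy, the vertices other than x, y reachable from x are closed off, and a second
neighbour of x is among them; so they are all the others. -/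
theorem connected_of_edgesNonseparating {V : Type u} [Nonempty V] {G : SimpleGraph V}
    (hd : G.MinDegreeTwo) (hn : G.EdgesNonseparating) : G.Connected := by
  refine (connected_iff_exists_forall_reachable _).2 ?_
  let x : V := Classical.arbitrary V
  obtain ⟨y, hxy, -⟩ := hd x x
  obtain ⟨w, hxw, hwy⟩ := hd x y
  refine ⟨x, fun z => ?_⟩
  have := hn x y hxy {z | G.Reachable x z ∧ z ≠ x ∧ z ≠ y} ⟨by simp, by simp, ?_⟩
    ⟨w, hxw.reachable, hxw.ne', hwy⟩ z
  · rcases this with rfl | rfl | h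
    exacts [Reachable.refl _, hxy.reachable, h.1]
  · intro c hc d hcd
    have := hc.1.trans hcd.reachable
    simp only [Set.mem_ofPred_eq]
    tauto

/-- Before any reduction every edge is in R, so only the separation clause has content. -/
theorem IsInK1.isReducible {V : Type u} [Finite V] {G : SimpleGraph V} (hG : G.IsInK1) :
    G.IsReducible Set.univ where
  leaf_of_separation x y C hxy hC hne hmin hout := by
    have : Nonempty V := ⟨x⟩
    obtain ⟨hd, hn⟩ := hG.1.minDegreeTwo_and_edgesNonseparating
    obtain ⟨K, hK⟩ := exists_componentCompl_supp_eq hC hne hmin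
    obtain ⟨z, hzC, hzx, hzy⟩ := hout
    have hz : z ∉ ({x, y} : Set V) := by simp [hzx, hzy]
    have hcut : G.IsTwoCut x y := by
      refine ⟨hxy, ?_⟩
      have hcon := connected_of_edgesNonseparating hd hn
      have := hcon.preconnected.subsingleton_connectedComponent
      have hK2 : K ≠ G.componentComplMk hz := by
        rintro rfl
        exact hzC (hK ▸ G.componentComplMk_mem hz)
      have : Nontrivial (G.ComponentCompl {x, y}) := ⟨_, _, hK2⟩
      have : Finite (G.ComponentCompl {x, y}) := Quot.finite _
      exact (Finite.card_le_one_iff_subsingleton.2 inferInstance).trans_lt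
        Finite.one_lt_card
    have aux : ∀ w, w = x ∨ w = y → ((G.bridge x y K).neighborSet w).ncard = 1 →
        G.IsLeafTo Set.univ w C := by
      intro w hw hcard z hz hwz
      refine ⟨trivial, fun z' hz' hwz' => ?_⟩
      obtain ⟨a, ha⟩ := Set.ncard_eq_one.1 hcard
      have hmem : ∀ z ∈ C, G.Adj w z → z = a := by
        intro z hz hwz
        have : z ∈ (G.bridge x y K).neighborSet w := by
          simp only [bridge, Subgraph.mem_neighborSet, Subgraph.induce_adj, Subgraph.top_adj, hK]
          exact ⟨.inr (by simpa using hw), .inl hz, hwz⟩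
        rwa [ha] at this
      rw [hmem z hz hwz, hmem z' hz' hwz']
    exact (hG.2 x y hcut K).imp (aux x (.inl rfl)) (aux y (.inr rfl))
  leaf_of_edge x y _ h := absurd trivial h

end SimpleGraph

namespace SimpleGraph

/-! ### Weighted colourings and partition functions -/

section Series

variable {R : Type*} [CommRing R]

/-- The weight of two edges in series with `q` colours, when the outer ends have equal colours.
An edge with weights `a`, `b` contributes `a` if its ends differ in colour and `b` otherwise. -/
def seriesSame (q a₁ b₁ a₂ b₂ : R) : R := b₁ * b₂ + (q - 1) * a₁ * a₂

/-- The weight of two edges in series, when the outer ends have different colours. -/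
def seriesDiff (q a₁ b₁ a₂ b₂ : R) : R := (q - 2) * a₁ * a₂ + a₁ * b₂ + a₂ * b₁

theorem sum_series (n : ℕ) (i j : Fin n) (a₁ b₁ a₂ b₂ : R) :
    ∑ c, (if i = c then b₁ else a₁) * (if j = c then b₂ else a₂) =
      if i = j then seriesSame (n : R) a₁ b₁ a₂ b₂ else seriesDiff (n : R) a₁ b₁ a₂ b₂ := by
  -- Each factor is a + (b - a)·[equal colours]; the product is expanded so that the indicators can
  -- be summed.
  have h2 : ∀ c : Fin n, (if i = c then b₁ else a₁) * (if j = c then b₂ else a₂) =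
      a₁ * a₂ + (if i = c then (b₁ - a₁) * a₂ else 0) + (if j = c then (b₂ - a₂) * a₁ else 0) +
        (if i = c then (if j = c then (b₁ - a₁) * (b₂ - a₂) else 0) else 0) := by
    intro c; split_ifs <;> ring
  simp_rw [h2, Finset.sum_add_distrib, Finset.sum_ite_eq, Finset.mem_univ, if_true,
    Finset.sum_const, Finset.card_univ, Fintype.card_fin, nsmul_eq_mul, seriesSame, seriesDiff]
  by_cases hij : i = j
  · simp only [hij, if_true]; ring
  · simp only [hij, Ne.symm hij, if_false]; ring

theorem sum_sum_ite_eq (n : ℕ) (a b : R) :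
    ∑ i : Fin n, ∑ j : Fin n, (if i = j then b else a) = n * (b + (n - 1) * a) := by
  have h : ∀ i j : Fin n, (if i = j then b else a) = a + if i = j then b - a else 0 := by
    intros; split_ifs <;> ring
  simp_rw [h, Finset.sum_add_distrib, Finset.sum_ite_eq, Finset.mem_univ, if_true,
    Finset.sum_const, Finset.card_univ, Fintype.card_fin, nsmul_eq_mul]
  ring

end Series

open Classical in
/-- The contribution of the edge `e` to the weight of the colouring `f`. -/
noncomputable def edgeWeight {V : Type u} {R α : Type*} (A B : Sym2 V → R) (f : V → α)
    (e : Sym2 V) : R :=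
  if (e.map f).IsDiag then B e else A e

theorem edgeWeight_mk {V : Type u} {R α : Type*} [DecidableEq α] (A B : Sym2 V → R) (f : V → α)
    (x y : V) : edgeWeight A B f s(x, y) = if f x = f y then B s(x, y) else A s(x, y) := by
  unfold edgeWeight
  congr 1

open Classical in
/-- The sum over all, not necessarily proper, `n`-colourings of the product of the edge weights. -/
noncomputable def partitionFunction {V : Type u} [Fintype V] (G : SimpleGraph V) {R : Type*}
    [CommRing R] (A B : Sym2 V → R) (n : ℕ) : R :=
  ∑ f : V → Fin n, ∏ e ∈ G.edgeFinset, edgeWeight A B f e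

namespace IsDoubleSubdivisionMap

variable {V W : Type u} {G : SimpleGraph V} {G' : SimpleGraph W} {u v : V} {ι : V → W}
  {m : Fin 2 → W} {R : Type*} [CommRing R]

open Classical in
theorem prod_edgeFinset (h : IsDoubleSubdivisionMap G G' u v ι m) [Fintype V] [Fintype W]
    (w : Sym2 W → R) :
    ∏ e ∈ G'.edgeFinset, w e = (∏ e ∈ G.edgeFinset.erase s(u, v), w (e.map ι)) *
      ∏ i, (w s(ι u, m i) * w s(ι v, m i)) := by
  have hi := h.inj
  have hE : G'.edgeFinset = (G.edgeFinset.erase s(u, v)).image (Sym2.map ι) ∪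
      (Finset.univ ×ˢ {u, v}).image (fun p : Fin 2 × V => s(ι p.2, m p.1)) := by
    ext e
    induction e using Sym2.ind with
    | h a b =>
      simp only [mem_edgeFinset, mem_edgeSet, Finset.mem_union, Finset.mem_image,
        Finset.mem_erase, Finset.mem_product, Finset.mem_univ, true_and, Prod.exists,
        Finset.mem_insert, Finset.mem_singleton]
      constructor
      · intro hab
        rcases h.cover a with ⟨x, rfl⟩ | ⟨i, rfl⟩ <;> rcases h.cover b with ⟨y, rfl⟩ | ⟨j, rfl⟩
        · obtain ⟨h1, h2⟩ := (h.adj_old x y).1 hab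
          exact .inl ⟨s(x, y), ⟨h2, h1⟩, rfl⟩
        · exact .inr ⟨j, x, (h.adj_new x j).1 hab, rfl⟩
        · exact .inr ⟨i, y, (h.adj_new y i).1 hab.symm, Sym2.eq_swap⟩
        · exact absurd hab (h.not_adj_new i j)
      · rintro (⟨e, ⟨h1, h2⟩, he⟩ | ⟨i, x, hx, he⟩)
        · induction e using Sym2.ind with
          | h x y =>
            rw [← mem_edgeSet, ← he]
            exact (h.adj_old x y).2 ⟨h2, h1⟩
        · rw [← mem_edgeSet, ← he]
          exact (h.adj_new x i).2 hx
  rw [hE, Finset.prod_union, Finset.prod_image, Finset.prod_image, Finset.prod_product]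
  · congr 1
    refine Finset.prod_congr rfl fun i _ => ?_
    rw [Finset.prod_pair h.base.ne]
  · rintro ⟨i, x⟩ - ⟨j, y⟩ - he
    rcases Sym2.eq_iff.1 he with ⟨h1, h2⟩ | ⟨h1, -⟩
    · exact Prod.ext (h.new_inj h2) (hi h1)
    · exact absurd h1 (h.ne _ _)
  · exact (Sym2.map.injective hi).injOn
  · rw [Finset.disjoint_left]
    intro e he he'
    obtain ⟨e, -, rfl⟩ := Finset.mem_image.1 he
    obtain ⟨p, -, hp⟩ := Finset.mem_image.1 he'
    induction e using Sym2.ind with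
    | h x y =>
      rcases Sym2.eq_iff.1 hp with ⟨-, h1⟩ | ⟨-, h1⟩
      exacts [h.ne _ _ h1.symm, h.ne _ _ h1.symm]

theorem sum_colouring (h : IsDoubleSubdivisionMap G G' u v ι m) [Fintype V] [Fintype W] (n : ℕ)
    (F : (V → Fin n) → (Fin 2 → Fin n) → R) [DecidableEq V] [DecidableEq W] :
    ∑ f : W → Fin n, F (f ∘ ι) (f ∘ m) = ∑ g, ∑ k, F g k := by
  have hb : Function.Bijective (Sum.elim ι m) := by
    refine ⟨h.inj.sumElim h.new_inj h.ne, fun w => ?_⟩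
    rcases h.cover w with ⟨x, rfl⟩ | ⟨i, rfl⟩
    exacts [⟨.inl x, rfl⟩, ⟨.inr i, rfl⟩]
  rw [← Fintype.sum_prod_type']
  refine Fintype.sum_equiv (((Equiv.ofBijective _ hb).arrowCongr (Equiv.refl _)).symm.trans
    (Equiv.sumArrowEquivProdArrow _ _ _)) _ _ fun f => rfl

open Classical in
/-- The weights of `G` that give it the partition function of its double subdivision. -/
noncomputable def reducedWeight (u v : V) (ι : V → W) (C : Sym2 W → R) (c : R) (e : Sym2 V) : R :=
  if e = s(u, v) then c else C (e.map ι)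

/-- For fixed old colours the sum over the colours of the two non-adjacent new vertices factors.
Each factor depends only on whether u and v agree in colour, so the product acts as a weight on uv.
-/
theorem partitionFunction_eq (h : IsDoubleSubdivisionMap G G' u v ι m) [Fintype V] [Fintype W]
    (A B : Sym2 W → R) (n : ℕ) :
    G'.partitionFunction A B n = G.partitionFunction
      (reducedWeight u v ι A (∏ i, seriesDiff (n : R) (A s(ι u, m i)) (B s(ι u, m i))
        (A s(ι v, m i)) (B s(ι v, m i))))
      (reducedWeight u v ι B (∏ i, seriesSame (n : R) (A s(ι u, m i)) (B s(ι u, m i))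
        (A s(ι v, m i)) (B s(ι v, m i)))) n := by
  classical
  let F (g : V → Fin n) (k : Fin 2 → Fin n) : R := (∏ e ∈ G.edgeFinset.erase s(u, v),
    edgeWeight (A ∘ Sym2.map ι) (B ∘ Sym2.map ι) g e) *
      ∏ i, ((if g u = k i then B s(ι u, m i) else A s(ι u, m i)) *
        (if g v = k i then B s(ι v, m i) else A s(ι v, m i)))
  have h1 : ∀ f : W → Fin n, ∏ e ∈ G'.edgeFinset, edgeWeight A B f e = F (f ∘ ι) (f ∘ m) := by
    intro f
    rw [h.prod_edgeFinset]
    simp only [edgeWeight_mk]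
    congr 1
    refine Finset.prod_congr rfl fun e _ => ?_
    simp [edgeWeight, Sym2.map_map]
  unfold partitionFunction
  rw [Finset.sum_congr rfl fun f _ => h1 f, h.sum_colouring n F]
  refine Finset.sum_congr rfl fun g _ => ?_
  have hmem : s(u, v) ∈ G.edgeFinset := by simpa using h.base
  rw [← Finset.mul_prod_erase _ _ hmem, ← Finset.mul_sum, mul_comm]
  congr 1
  · rw [edgeWeight_mk]
    simp only [reducedWeight, if_true]
    -- Distributivity: the sum over pairs of new colours is a product of two sums.
    rw [← Fintype.piFinset_univ, ← Finset.prod_univ_sum (fun _ => Finset.univ) (fun i c =>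
      (if g u = c then B s(ι u, m i) else A s(ι u, m i)) *
          (if g v = c then B s(ι v, m i) else A s(ι v, m i)))]
    simp only [sum_series]
    split_ifs <;> rfl
  · refine Finset.prod_congr rfl fun e he => ?_
    simp [edgeWeight, reducedWeight, (Finset.mem_erase.1 he).1]

end IsDoubleSubdivisionMap

/-- The vertex `e.symm 1` is summed out as two edges in series, parallel to the remaining edge. -/
theorem partitionFunction_triangle {V : Type u} [Fintype V] {G : SimpleGraph V}
    (e : G ≃g (⊤ : SimpleGraph (Fin 3))) {R : Type*} [CommRing R] (A B : Sym2 V → R) (n : ℕ) :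
    G.partitionFunction A B n =
      n * (B s(e.symm 0, e.symm 2) * seriesSame (n : R) (A s(e.symm 0, e.symm 1))
          (B s(e.symm 0, e.symm 1)) (A s(e.symm 2, e.symm 1)) (B s(e.symm 2, e.symm 1)) +
        (n - 1) * (A s(e.symm 0, e.symm 2) * seriesDiff (n : R) (A s(e.symm 0, e.symm 1))
          (B s(e.symm 0, e.symm 1)) (A s(e.symm 2, e.symm 1)) (B s(e.symm 2, e.symm 1)))) := by
  classical
  have hE : G.edgeFinset = {s(e.symm 0, e.symm 2), s(e.symm 0, e.symm 1),
      s(e.symm 2, e.symm 1)} := by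
    ext p
    induction p using Sym2.ind with
    | h a b =>
      obtain ⟨a, rfl⟩ := e.symm.surjective a
      obtain ⟨b, rfl⟩ := e.symm.surjective b
      rw [mem_edgeFinset, mem_edgeSet, e.symm.map_adj_iff, top_adj]
      simp only [Finset.mem_insert, Finset.mem_singleton, Sym2.eq_iff, e.symm.injective.eq_iff]
      revert a b
      decide
  unfold partitionFunction
  rw [hE]
  let F (i j k : Fin n) : R :=
    (if i = k then B s(e.symm 0, e.symm 2) else A s(e.symm 0, e.symm 2)) *
      ((if i = j then B s(e.symm 0, e.symm 1) else A s(e.symm 0, e.symm 1)) *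
        (if k = j then B s(e.symm 2, e.symm 1) else A s(e.symm 2, e.symm 1)))
  have h1 : ∀ f : V → Fin n, ∏ p ∈ {s(e.symm 0, e.symm 2), s(e.symm 0, e.symm 1),
      s(e.symm 2, e.symm 1)}, edgeWeight A B f p =
      F (f (e.symm 0)) (f (e.symm 1)) (f (e.symm 2)) := by
    intro f
    rw [Finset.prod_insert, Finset.prod_pair]
    · simp only [edgeWeight_mk, F]
    · simp [e.symm.injective.eq_iff]
    · simp [e.symm.injective.eq_iff]
  have h2 : ∑ f : V → Fin n, F (f (e.symm 0)) (f (e.symm 1)) (f (e.symm 2)) =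
      ∑ i, ∑ k, ∑ j, F i j k := by
    let E : (V → Fin n) ≃ Fin n × Fin n × Fin n :=
      { toFun := fun f => (f (e.symm 0), f (e.symm 2), f (e.symm 1))
        invFun := fun p => ![p.1, p.2.2, p.2.1] ∘ e
        left_inv := fun f => by
          funext x
          obtain ⟨x, rfl⟩ := e.symm.surjective x
          fin_cases x <;> simp
        right_inv := fun p => by simp }
    refine (Fintype.sum_equiv E _ (fun p => F p.1 p.2.2 p.2.1) (fun f => rfl)).trans ?_
    simp_rw [Fintype.sum_prod_type]
  rw [Finset.sum_congr rfl fun f _ => h1 f, h2]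
  rw [← sum_sum_ite_eq]
  refine Finset.sum_congr rfl fun i _ => Finset.sum_congr rfl fun k _ => ?_
  simp only [F]
  rw [← Finset.mul_sum, sum_series]
  split_ifs <;> rfl

theorem eval_chromaticPolynomial_eq_partitionFunction {V : Type u} [Fintype V] (G : SimpleGraph V)
    (n : ℕ) : (G.chromaticPolynomial.map (Int.castRingHom ℝ)).eval (n : ℝ) =
      G.partitionFunction (fun _ => (1 : ℝ)) (fun _ => 0) n := by
  classical
  have e : G.Coloring (Fin n) ≃ {f : V → Fin n // ∀ a b, G.Adj a b → f a ≠ f b} :=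
    { toFun := fun c => ⟨c, fun a b h => c.valid h⟩
      invFun := fun f => Coloring.mk f.1 (fun {a b} h => f.2 a b h)
      left_inv := fun c => rfl
      right_inv := fun f => rfl }
  have h := congrArg (Int.cast (R := ℝ)) (G.chromaticPolynomial_eval n)
  rw [Polynomial.eval_natCast_map, eq_intCast, h, Nat.card_congr e, Nat.card_eq_fintype_card,
    Fintype.card_subtype, Finset.card_filter, Int.cast_natCast, Nat.cast_sum]
  refine Finset.sum_congr rfl fun f _ => ?_
  split_ifs with hf
  · rw [Finset.prod_eq_one]
    · simp
    · intro p hp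
      induction p using Sym2.ind with
      | h a b =>
        rw [edgeWeight_mk, if_neg (hf a b (by simpa using hp))]
  · push Not at hf
    obtain ⟨a, b, hab, hf⟩ := hf
    rw [Finset.prod_eq_zero (i := s(a, b)) (by simpa using hab) (by simp [edgeWeight_mk, hf])]
    simp

end SimpleGraph

namespace SimpleGraph

/-! ### Estimates on (1, 5/4] and the induction -/

/-- Edge weights `a`, `b` with positive `a` and with ratio `b / a` at most `1 / 4`. -/
structure IsAdmissibleWeight {V : Type u} (G : SimpleGraph V) (a b : Sym2 V → ℝ) : Prop where
  pos : ∀ e ∈ G.edgeSet, 0 < a e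
  le : ∀ e ∈ G.edgeSet, b e ≤ a e / 4

/-- With b₁b₂ = 0 the equal-colour weight is (t - 1)a₁a₂ ≤ a₁a₂/4, and the other is at most (-3/4 +
1/4)a₁a₂. The ratio 1/2 is squared by the two parallel paths, which restores exactly the bound 1/4.
-/
theorem series_bounds {t a₁ b₁ a₂ b₂ : ℝ} (ht : 1 < t) (ht' : t ≤ 5 / 4) (ha₁ : 0 < a₁)
    (ha₂ : 0 < a₂) (hb₁ : b₁ ≤ a₁ / 4) (hb₂ : b₂ ≤ a₂ / 4) (h : b₁ = 0 ∨ b₂ = 0) :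
    seriesDiff t a₁ b₁ a₂ b₂ < 0 ∧ 0 < seriesSame t a₁ b₁ a₂ b₂ ∧
      seriesSame t a₁ b₁ a₂ b₂ ≤ -seriesDiff t a₁ b₁ a₂ b₂ / 2 := by
  have hp := mul_pos ha₁ ha₂
  have h1 : a₁ * b₂ + a₂ * b₁ ≤ a₁ * a₂ / 4 := by
    rcases h with rfl | rfl
    · nlinarith
    · nlinarith
  have h2 : b₁ * b₂ = 0 := by rcases h with rfl | rfl <;> simp
  have h3 : (t - 2) * a₁ * a₂ ≤ -(3 / 4) * (a₁ * a₂) := by nlinarith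
  have h4 : 0 < (t - 1) * a₁ * a₂ := by rw [mul_assoc]; exact mul_pos (by linarith) hp
  have h5 : (t - 1) * a₁ * a₂ ≤ 1 / 4 * (a₁ * a₂) := by nlinarith
  unfold seriesSame seriesDiff
  refine ⟨by linarith, by linarith, by linarith⟩

/-- Once b₁b₂b₃ = 0 a factor t(t - 1) splits off. At most two terms with a b remain, each at most
a₁a₂a₃/4, against (t - 2)a₁a₂a₃ ≤ -(3/4)a₁a₂a₃. -/
theorem triangle_neg {t a₁ b₁ a₂ b₂ a₃ b₃ : ℝ} (ht : 1 < t) (ht' : t ≤ 5 / 4) (ha₁ : 0 < a₁)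
    (ha₂ : 0 < a₂) (ha₃ : 0 < a₃) (hb₁ : b₁ ≤ a₁ / 4) (hb₂ : b₂ ≤ a₂ / 4) (hb₃ : b₃ ≤ a₃ / 4)
    (h : b₁ = 0 ∨ b₂ = 0 ∨ b₃ = 0) :
    t * (b₃ * seriesSame t a₁ b₁ a₂ b₂ + (t - 1) * (a₃ * seriesDiff t a₁ b₁ a₂ b₂)) < 0 := by
  have h12 := mul_pos ha₁ ha₂
  have h123 := mul_pos h12 ha₃
  have e1 : a₁ * a₂ * b₃ ≤ a₁ * a₂ * a₃ / 4 := by nlinarith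
  have e2 : a₁ * a₃ * b₂ ≤ a₁ * a₂ * a₃ / 4 := by nlinarith [mul_pos ha₁ ha₃]
  have e3 : a₂ * a₃ * b₁ ≤ a₁ * a₂ * a₃ / 4 := by nlinarith [mul_pos ha₂ ha₃]
  have e4 : (t - 2) * (a₁ * a₂ * a₃) ≤ -(3 / 4) * (a₁ * a₂ * a₃) := by nlinarith
  have h0 : b₁ * b₂ * b₃ = 0 := by rcases h with rfl | rfl | rfl <;> simp
  have key : b₃ * seriesSame t a₁ b₁ a₂ b₂ + (t - 1) * (a₃ * seriesDiff t a₁ b₁ a₂ b₂) =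
      (t - 1) * ((t - 2) * (a₁ * a₂ * a₃) + a₁ * a₂ * b₃ + a₁ * a₃ * b₂ + a₂ * a₃ * b₁) := by
    unfold seriesSame seriesDiff
    linear_combination h0
  rw [key]
  refine mul_neg_of_pos_of_neg (by linarith) (mul_neg_of_pos_of_neg (by linarith) ?_)
  rcases h with rfl | rfl | rfl <;> simp only [mul_zero] at * <;> linarith

theorem IsReducible.exists_mem_triangle {V : Type u} {G : SimpleGraph V} {R : Set (Sym2 V)}
    (hr : G.IsReducible R) {x y z : V} (hxy : G.Adj x y) (hyz : G.Adj y z) (hxz : G.Adj x z) :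
    s(x, y) ∈ R ∨ s(z, y) ∈ R ∨ s(x, z) ∈ R := by
  by_cases h : s(x, y) ∈ R
  · exact .inl h
  · rcases hr.leaf_of_edge x y hxy h with h | h
    · exact .inr (.inr (h z hyz.ne' hxz).1)
    · have := (h z hxz.ne' hyz).1
      rw [Sym2.eq_swap] at this
      exact .inr (.inl this)

/-- The weights are polynomials in the number of colours: the reductions are proved at natural
numbers, where colourings can be counted, while signs are read off at the real t. At the triangle,
agreement at all naturals becomes an identity of polynomials. -/
theorem IsGeneralisedTriangle.eval_neg {V : Type u} {G : SimpleGraph V}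
    (hG : G.IsGeneralisedTriangle) {t : ℝ} (ht : 1 < t) (ht' : t ≤ 5 / 4) (p : ℝ[X]) :
    ∀ [Fintype V] (A B : Sym2 V → ℝ[X]),
      (∀ n : ℕ, p.eval (n : ℝ) =
        G.partitionFunction (fun e => (A e).eval (n : ℝ)) (fun e => (B e).eval (n : ℝ)) n) →
      G.IsAdmissibleWeight (fun e => (A e).eval t) (fun e => (B e).eval t) →
      G.IsReducible {e | (B e).eval t = 0} → p.eval t < 0 := by
  induction hG with
  | @triangle V G e =>
    intro _ A B hp hw hr
    have hadj : ∀ i j, i ≠ j → G.Adj (e.symm i) (e.symm j) := fun i j hij =>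
      e.symm.map_adj_iff.2 hij
    have hpe : p = Polynomial.X * (B s(e.symm 0, e.symm 2) * seriesSame Polynomial.X
          (A s(e.symm 0, e.symm 1)) (B s(e.symm 0, e.symm 1)) (A s(e.symm 2, e.symm 1))
          (B s(e.symm 2, e.symm 1)) +
        (Polynomial.X - 1) * (A s(e.symm 0, e.symm 2) * seriesDiff Polynomial.X
          (A s(e.symm 0, e.symm 1)) (B s(e.symm 0, e.symm 1)) (A s(e.symm 2, e.symm 1))
          (B s(e.symm 2, e.symm 1)))) := by
      refine Polynomial.eq_of_infinite_eval_eq _ _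
        ((Set.infinite_range_of_injective (Nat.cast_injective (R := ℝ))).mono ?_)
      rintro _ ⟨n, rfl⟩
      simp [hp, partitionFunction_triangle e, seriesSame, seriesDiff]
    have h01 := hadj 0 1 (by decide)
    have h21 := hadj 2 1 (by decide)
    have h02 := hadj 0 2 (by decide)
    have := triangle_neg ht ht' (hw.pos _ h01) (hw.pos _ h21) (hw.pos _ h02) (hw.le _ h01)
      (hw.le _ h21) (hw.le _ h02) (hr.exists_mem_triangle h01 h21.symm h02)
    simpa [hpe, seriesSame, seriesDiff] using this
  | @doubleSubdivision V W G G' u v hG huv e ih =>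
    intro _ A B hp hw hr
    have h := IsDoubleSubdivisionMap.of_iso huv e
    set ι : V → W := fun x => e.symm (.inl x)
    set m : Fin 2 → W := fun i => e.symm (.inr i)
    obtain ⟨hd, hn⟩ := hG.minDegreeTwo_and_edgesNonseparating
    have := Fintype.ofInjective ι h.inj
    have hs : ∀ i, _ := fun i => series_bounds ht ht'
      (hw.pos s(ι u, m i) ((h.adj_new u i).2 (.inl rfl)))
      (hw.pos s(ι v, m i) ((h.adj_new v i).2 (.inr rfl)))
      (hw.le s(ι u, m i) ((h.adj_new u i).2 (.inl rfl)))
      (hw.le s(ι v, m i) ((h.adj_new v i).2 (.inr rfl)))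
      (h.new_edge_mem hd hr i)
    have hold : ∀ e ∈ G.edgeSet, e ≠ s(u, v) → e.map ι ∈ G'.edgeSet := by
      intro e he hne
      induction e using Sym2.ind with
      | h x y => exact (h.adj_old x y).2 ⟨he, hne⟩
    refine ih (IsDoubleSubdivisionMap.reducedWeight u v ι A
        (∏ i, seriesDiff Polynomial.X (A s(ι u, m i)) (B s(ι u, m i))
          (A s(ι v, m i)) (B s(ι v, m i))))
      (IsDoubleSubdivisionMap.reducedWeight u v ι B
        (∏ i, seriesSame Polynomial.X (A s(ι u, m i)) (B s(ι u, m i))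
          (A s(ι v, m i)) (B s(ι v, m i)))) ?_ ?_ ?_
    · intro n
      rw [hp, h.partitionFunction_eq]
      congr 1 <;>
      · funext e
        unfold IsDoubleSubdivisionMap.reducedWeight
        split_ifs <;> simp [seriesSame, seriesDiff]
    · simp only [seriesSame, seriesDiff] at hs
      have h0 := hs 0
      have h1 := hs 1
      refine ⟨fun e he => ?_, fun e he => ?_⟩ <;>
      by_cases hne : e = s(u, v) <;>
      simp only [IsDoubleSubdivisionMap.reducedWeight, hne, if_true, if_false, seriesSame,
        seriesDiff, Fin.prod_univ_two, Polynomial.eval_mul, Polynomial.eval_add,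
        Polynomial.eval_sub, Polynomial.eval_X, Polynomial.eval_one, Polynomial.eval_ofNat]
      · exact mul_pos_of_neg_of_neg h0.1 h1.1
      · exact hw.pos _ (hold e he hne)
      -- Two ratios of at most 1/2 multiply to at most 1/4.
      · have := mul_le_mul h0.2.2 h1.2.2 h1.2.1.le (by linarith [h0.1])
        linarith
      · exact hw.le _ (hold e he hne)
    · refine h.isReducible hd hn hr fun e hne => ?_
      simp [IsDoubleSubdivisionMap.reducedWeight, hne]

end SimpleGraph

open SimpleGraph in
theorem lemma14 {V : Type u} [Fintype V] (G : SimpleGraph V) (hG : G.IsInK1)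
    (t : ℝ) (ht : t ∈ Set.Ioc (1 : ℝ) (5 / 4)) :
    0 < (-1 : ℝ) ^ Fintype.card V * Polynomial.aeval t G.chromaticPolynomial := by
  have hodd := hG.1.odd_card.2
  rw [Nat.card_eq_fintype_card] at hodd
  -- With a = 1 and b = 0 the zero set of b is everything, as `IsInK1.isReducible` requires.
  have key := hG.1.eval_neg ht.1 ht.2 (G.chromaticPolynomial.map (Int.castRingHom ℝ))
    (fun _ => 1) (fun _ => 0)
    (fun n => by simpa using eval_chromaticPolynomial_eq_partitionFunction G n)
    ⟨by simp, by simp⟩ (by simpa [Set.ofPred_true] using hG.isReducible)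
  rw [hodd.neg_one_pow, Polynomial.aeval_def, ← Polynomial.eval_map]
  simpa using key
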